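/- Let $(X,d)$ be an Hadamard space, i.e. a nonempty complete $\mathrm{CAT}(0)$ space (a metric space with unique geodesics satisfying the $\mathrm{CAT}(0)$ comparison inequality). For $x,y\in X$ and $\alpha\in[0,1]$ let $(1-\alpha)x\oplus\alpha y=\gamma(\alpha\, d(x,y))$, where $\gamma\colon[0,d(x,y)]\to X$ is the geodesic from $x$ to $y$. For $x,y,z,w\in X$ put $$\langle\overrightarrow{xy},\overrightarrow{zw}\rangle=\tfrac12\bigl(d(x,w)^2+d(y,z)^2-d(x,z)^2-d(y,w)^2\bigr).$$ For $(\alpha,x,y)\in\mathbb R\times X^2$ let $\Phi(\alpha\overrightarrow{xy})\colon X\to\mathbb R$ be the Lipschitz function $p\mapsto\alpha\langle\overrightarrow{xy},\overrightarrow{xp}\rangle$. The dual space $X^*$ of Ahmadi Kakavandi and Amini is the set of equivalence classes $[\alpha\overrightarrow{xy}]$ of elements of $\mathbb R\times X^2$, where $\alpha\overrightarrow{xy}\sim\beta\overrightarrow{zw}$ means that $\Phi(\alpha\overrightarrow{xy})-\Phi(\beta\overrightarrow{zw})$ has Lipschitz seminorm $0$; write $\overrightarrow{xy}$ for $1\overrightarrow{xy}$.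 Its origin is $0=[\overrightarrow{aa}]$ (for any $a\in X$), and $\langle u^*,\overrightarrow{pq}\rangle=\alpha\langle\overrightarrow{xy},\overrightarrow{pq}\rangle$ for $u^*=[\alpha\overrightarrow{xy}]\in X^*$ and $p,q\in X$. Let $A\colon X\to2^{X^*}$ be a monotone operator, i.e. $\langle u^*,\overrightarrow{vu}\rangle-\langle v^*,\overrightarrow{vu}\rangle\ge0$ whenever $u^*\in Au$ and $v^*\in Av$, which satisfies the range condition: for each $x\in X$ there exists $z\in X$ with $[\overrightarrow{zx}]\in Az$. This $z$ is then unique; let $J_Ax$ denote it (the resolvent of $A$), and let $A^{-1}(0)=\{u\in X:0\in Au\}$. Let $\{\alpha_n\}_{n\ge1}$ be a sequence in $(0,1]$ with $\sum_{n=1}^\infty\alpha_n=\infty$, and let $\{x_n\}_{n\ge1}$ be defined by $x_1\in X$ and $$x_{n+1}=(1-\alpha_n)x_n\oplus\alpha_nJ_Ax_n\qquad(n\ge1).$$ Then the following hold. (i) $A^{-1}(0)$ is nonempty if and only if $\{x_n\}$ is bounded. (ii) If $A^{-1}(0)$ is nonempty and $\inf_n\alpha_n(1-\alpha_n)>0$,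 then $\{x_n\}$ is $\Delta$-convergent to an element $p$ of $A^{-1}(0)$; that is, for every subsequence $\{x_{n_i}\}$ of $\{x_n\}$, the set of all $u\in X$ with $\limsup_i d(u,x_{n_i})=\inf_{y\in X}\limsup_i d(y,x_{n_i})$ (upper limits in $[0,\infty]$) is $\{p\}$. -/

import Mathlib

namespace CAT0

open Filter Topology
open scoped ENNReal

variable {X : Type*} [MetricSpace X]

/-! ### Geodesics, `CAT(0)` spaces -/

/-- `γ : [0, d(x,y)] → X` is a geodesic from `x` to `y`. -/
def IsGeodesic (x y : X) (γ : Set.Icc (0 : ℝ) (dist x y) → X) : Prop :=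
  γ ⟨0, le_rfl, dist_nonneg⟩ = x ∧ γ ⟨dist x y, dist_nonneg, le_rfl⟩ = y ∧
    ∀ s t, dist (γ s) (γ t) = |(s : ℝ) - t|

/-- Any two points are joined by exactly one geodesic. -/
class UniquelyGeodesic (X : Type*) [MetricSpace X] : Prop where
  existsUnique_geodesic : ∀ x y : X, ∃! γ, IsGeodesic x y γ

/-- The geodesic from `x` to `y`. -/
noncomputable def geodesic [UniquelyGeodesic X] (x y : X) :
    Set.Icc (0 : ℝ) (dist x y) → X :=
  (UniquelyGeodesic.existsUnique_geodesic x y).choose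

/-- `geoComb x y a` is the point `(1 - a) x ⊕ a y`, i.e. `γ (a * d(x,y))` where `γ` is the
geodesic from `x` to `y`, for `a ∈ [0,1]`. -/
noncomputable def geoComb [UniquelyGeodesic X] (x y : X) (a : Set.Icc (0 : ℝ) 1) : X :=
  geodesic x y ⟨a * dist x y, mul_nonneg a.2.1 dist_nonneg,
    mul_le_of_le_one_left dist_nonneg a.2.2⟩

/-- `CAT(0)` spaces: uniquely geodesic spaces with the comparison inequality. A complete
`CAT(0)` space is a Hadamard space. -/
class CAT0Space (X : Type*) [MetricSpace X] : Prop extends UniquelyGeodesic X where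
  comparison : ∀ (x y z : X) (x' y' z' : EuclideanSpace ℝ (Fin 2)),
    dist x y = ‖x' - y'‖ → dist y z = ‖y' - z'‖ → dist z x = ‖z' - x'‖ →
    ∀ a b : Set.Icc (0 : ℝ) 1,
      dist (geoComb x y a) (geoComb x z b) ≤
        ‖((1 - (a : ℝ)) • x' + (a : ℝ) • y') - ((1 - (b : ℝ)) • x' + (b : ℝ) • z')‖

/-! ### The dual space -/

/-- The quasilinearization `⟨xy, zw⟩` of Berg and Nikolaev. -/
noncomputable def quasilin (x y z w : X) : ℝ :=
  (1 / 2) * (dist x w ^ 2 + dist y z ^ 2 - dist x z ^ 2 - dist y w ^ 2)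

/-- The Lipschitz seminorm of a real function, with value `∞` when the function is not
Lipschitz. (The terms with `p = q` are `0 / 0 = 0` in `[0,∞]`.) -/
noncomputable def lipSeminorm (f : X → ℝ) : ℝ≥0∞ :=
  ⨆ (p : X) (q : X), edist (f p) (f q) / edist p q

/-- `Phi (a, x, y)` is the function `p ↦ a ⟨xy, xp⟩`; the triple `(a, x, y)` stands for
`a xy ∈ ℝ × X²`. -/
noncomputable def Phi (t : ℝ × X × X) (p : X) : ℝ :=
  t.1 * quasilin t.2.1 t.2.2 t.2.1 p

/-- The pseudometric `(s, t) ↦ ‖Φ s - Φ t‖` on `ℝ × X²`. -/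
noncomputable def DHat (s t : ℝ × X × X) : ℝ≥0∞ :=
  lipSeminorm (Phi s - Phi t)

theorem lipSeminorm_eq_zero_iff (f : X → ℝ) : lipSeminorm f = 0 ↔ ∀ p q, f p = f q := by
  simp only [lipSeminorm, ENNReal.iSup_eq_zero, ENNReal.div_eq_zero_iff, edist_eq_zero,
    edist_ne_top, or_false]

theorem DHat_eq_zero_iff (s t : ℝ × X × X) :
    DHat s t = 0 ↔ ∀ p q,
      s.1 * quasilin s.2.1 s.2.2 p q = t.1 * quasilin t.2.1 t.2.2 p q := by
  rw [DHat, lipSeminorm_eq_zero_iff]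
  refine forall₂_congr fun p q => ?_
  simp only [Pi.sub_apply, Phi, quasilin]
  constructor <;> intro h <;> linarith

/-- The equivalence relation `s ∼ t ↔ DHat s t = 0` on `ℝ × X²`. -/
def dualSetoid (X : Type*) [MetricSpace X] : Setoid (ℝ × X × X) where
  r s t := DHat s t = 0
  iseqv :=
    { refl := fun s => (DHat_eq_zero_iff s s).2 fun _ _ => rfl
      symm := fun {s t} h =>
        (DHat_eq_zero_iff t s).2 fun p q => ((DHat_eq_zero_iff s t).1 h p q).symm
      trans := fun {s t u} h k => (DHat_eq_zero_iff s u).2 fun p q =>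
        ((DHat_eq_zero_iff s t).1 h p q).trans ((DHat_eq_zero_iff t u).1 k p q) }

/-- The dual space `X*` of Ahmadi Kakavandi and Amini: the set of classes `[a xy]`. -/
def Dual (X : Type*) [MetricSpace X] : Type _ :=
  Quotient (dualSetoid X)

/-- The class `[a xy]`. -/
def Dual.mk (a : ℝ) (x y : X) : Dual X :=
  Quotient.mk (dualSetoid X) (a, x, y)

/-- The origin `[aa]` of `X*`, which does not depend on the point `a` (see `Dual.mk_self`). -/
noncomputable instance [Nonempty X] : Zero (Dual X) :=
  ⟨Dual.mk 1 (Classical.arbitrary X) (Classical.arbitrary X)⟩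

theorem Dual.mk_self [Nonempty X] (a : ℝ) (x : X) : Dual.mk a x x = 0 := by
  refine Quotient.sound ((DHat_eq_zero_iff _ _).2 fun p q => ?_)
  simp only [quasilin]
  ring

/-- The pairing `⟨u*, pq⟩ = a ⟨xy, pq⟩` for `u* = [a xy]`. -/
noncomputable def Dual.pairing (u : Dual X) (p q : X) : ℝ :=
  Quotient.lift (s := dualSetoid X) (fun t => t.1 * quasilin t.2.1 t.2.2 p q)
    (fun s t h => (DHat_eq_zero_iff s t).1 h p q) u

/-! ### Monotone operators -/

/-- Monotonicity of a set-valued operator `A : X → 2^{X*}`. -/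
def IsMonotoneOp (A : X → Set (Dual X)) : Prop :=
  ∀ (u v : X) (u' v' : Dual X), u' ∈ A u → v' ∈ A v →
    0 ≤ u'.pairing v u - v'.pairing v u

/-- The range condition: for each `x` there is `z` with `[zx] ∈ A z`. -/
def RangeCondition (A : X → Set (Dual X)) : Prop :=
  ∀ x : X, ∃ z : X, Dual.mk 1 z x ∈ A z

theorem existsUnique_resolvent {A : X → Set (Dual X)} (hA : IsMonotoneOp A)
    (hR : RangeCondition A) (x : X) : ∃! z : X, Dual.mk 1 z x ∈ A z := by
  obtain ⟨z, hz⟩ := hR x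
  refine ⟨z, hz, fun w hw => ?_⟩
  have h : 0 ≤ 1 * quasilin w x z w - 1 * quasilin z x z w := hA w z _ _ hw hz
  simp only [quasilin, dist_self, dist_comm z w, dist_comm x] at h
  have h2 : dist w z ^ 2 ≤ 0 := by linarith
  exact dist_eq_zero.1 (pow_eq_zero_iff two_ne_zero |>.1 (le_antisymm h2 (sq_nonneg _)))

/-- The resolvent `J_A` of a monotone operator satisfying the range condition: `J_A x` is the
unique `z` with `[zx] ∈ A z`. -/
noncomputable def resolvent {A : X → Set (Dual X)} (hA : IsMonotoneOp A)
    (hR : RangeCondition A) (x : X) : X :=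
  (existsUnique_resolvent hA hR x).choose

/-- The zero point set `A⁻¹(0)`. -/
def zeroSet [Nonempty X] (A : X → Set (Dual X)) : Set X :=
  {u | 0 ∈ A u}

/-! ### `Δ`-convergence -/

/-- The asymptotic center of a sequence. The upper limits are taken in `[0,∞]`, so that it is
the whole space when the sequence is unbounded. -/
def asymptoticCenter (x : ℕ → X) : Set X :=
  {u | limsup (fun n => edist u (x n)) atTop = ⨅ y : X, limsup (fun n => edist y (x n)) atTop}

/-- `x` is `Δ`-convergent to `p`: every subsequence has asymptotic center `{p}`. -/
def DeltaConverges (x : ℕ → X) (p : X) : Prop :=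
  ∀ φ : ℕ → ℕ, StrictMono φ → asymptoticCenter (x ∘ φ) = {p}

end CAT0

namespace CAT0

open Filter Topology
open scoped ENNReal

/-! ### Upper limits of bounded real sequences. -/

section Limsup

/-! Zeros of `A` are the fixed points of its resolvent `J`, and monotonicity gives
`resolvent_dist_sq_le`. Fixed points come from minimizing a function `g` built from squared
distances: by `IsQuadraticGauge.exists_minimizer` it has a minimizer `p` with `g p + d(p,y)²/2 ≤ g
y`, so `g (J p) ≤ g p` forces `J p = p`.

For (i), `g` is the upper limit of the `α`-weighted averages of `d(·, J x_k)²`. The summed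
inequality bounds the increase from `p` to `J p` by `d(x_0, J p)² / ∑ α_k → 0`. Conversely,
distances to a fixed point decrease along the iteration.

For (ii), `d(x_n, J x_n) → 0`, so `g = limsup d(·, x_{φ n})²` also works for each subsequence. Since
`d(x_n, p)` converges for fixed `p`, an Opial-type comparison shows that all subsequences share one
minimizer. -/

theorem limsup_le_of_nonneg {a : ℕ → ℝ} {c : ℝ} (h0 : ∀ n, 0 ≤ a n) (h : ∀ᶠ n in atTop, a n ≤ c) :
    limsup a atTop ≤ c :=
  limsup_le_of_le (isBoundedUnder_of ⟨0, h0⟩ : IsBoundedUnder (· ≥ ·) atTop a).isCoboundedUnder_le h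

theorem eventually_lt_of_limsup_lt_of_bdd {a : ℕ → ℝ} {c : ℝ} (hM : ∃ M, ∀ n, a n ≤ M)
    (h : limsup a atTop < c) : ∀ᶠ n in atTop, a n < c :=
  eventually_lt_of_limsup_lt h (isBoundedUnder_of hM)

theorem limsup_le_limsup_of_le_add {a b δ : ℕ → ℝ} (h0 : ∀ n, 0 ≤ a n) (hM : ∃ M, ∀ n, b n ≤ M)
    (hδ : Tendsto δ atTop (𝓝 0)) (h : ∀ n, a n ≤ b n + δ n) :
    limsup a atTop ≤ limsup b atTop := by
  refine le_of_forall_pos_le_add fun ε hε => limsup_le_of_nonneg h0 ?_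
  filter_upwards [eventually_lt_of_limsup_lt_of_bdd hM
    (show limsup b atTop < limsup b atTop + ε / 2 by linarith),
    hδ.eventually (gt_mem_nhds (half_pos hε))] with n h1 h2
  linarith [h n]

end Limsup

/-! ### Comparison triangles and the CN inequality. -/

/-- A triangle in the Euclidean plane with prescribed side lengths. -/
theorem exists_comparison_triangle {a b c : ℝ} (ha : 0 ≤ a) (hb : 0 ≤ b) (hc : 0 ≤ c)
    (h1 : a ≤ b + c) (h2 : b ≤ a + c) (h3 : c ≤ a + b) :
    ∃ x y z : EuclideanSpace ℝ (Fin 2), a = ‖x - y‖ ∧ c = ‖y - z‖ ∧ b = ‖z - x‖ := by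
  rcases ha.eq_or_lt with rfl | ha
  · obtain rfl : b = c := by linarith
    refine ⟨0, 0, !₂[b, 0], ?_, ?_, ?_⟩
    · simp
    · simp [EuclideanSpace.norm_eq, Real.sqrt_sq hb]
    · simp [EuclideanSpace.norm_eq, Real.sqrt_sq hb]
  -- Law of cosines: `s` is the first coordinate of the apex, and the triangle inequalities give
  -- `|s| ≤ b`.
  · set s : ℝ := (a ^ 2 + b ^ 2 - c ^ 2) / (2 * a) with hs
    have hs' : 2 * a * s = a ^ 2 + b ^ 2 - c ^ 2 := by rw [hs]; field_simp
    have hsb : s ≤ b := by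
      rw [hs, div_le_iff₀ (by positivity)]
      nlinarith [mul_nonneg (sub_nonneg.2 h1) hc, mul_nonneg (sub_nonneg.2 h2) hc]
    have hsb' : -b ≤ s := by
      rw [hs, le_div_iff₀ (by positivity)]
      nlinarith [mul_nonneg (sub_nonneg.2 h3) (by positivity : 0 ≤ a + b + c)]
    have ht : 0 ≤ b ^ 2 - s ^ 2 := by nlinarith
    refine ⟨0, !₂[a, 0], !₂[s, √(b ^ 2 - s ^ 2)], ?_, ?_, ?_⟩
    · simp [EuclideanSpace.norm_eq, Real.sqrt_sq ha.le]
    · rw [EuclideanSpace.norm_eq, eq_comm, Real.sqrt_eq_iff_eq_sq (by positivity) hc]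
      simp [Fin.sum_univ_two, Real.sq_sqrt ht]
      linarith
    · rw [EuclideanSpace.norm_eq, eq_comm, Real.sqrt_eq_iff_eq_sq (by positivity) hb]
      simp [Fin.sum_univ_two, Real.sq_sqrt ht]

variable {X : Type*} [MetricSpace X]

theorem geoComb_one [UniquelyGeodesic X] (x y : X) (h : (1 : ℝ) ∈ Set.Icc (0 : ℝ) 1) :
    geoComb x y ⟨1, h⟩ = y := by
  have hg := (UniquelyGeodesic.existsUnique_geodesic x y).choose_spec.1.2.1
  simpa only [geoComb, geodesic, one_mul] using hg

theorem norm_sq_affine {E : Type*} [NormedAddCommGroup E] [InnerProductSpace ℝ E] (x y z : E)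
    (a : ℝ) : ‖((1 - a) • x + a • y) - z‖ ^ 2 =
      (1 - a) * ‖z - x‖ ^ 2 + a * ‖y - z‖ ^ 2 - a * (1 - a) * ‖x - y‖ ^ 2 := by
  have e1 : ((1 - a) • x + a • y) - z = (1 - a) • (x - z) + a • (y - z) := by module
  have e2 : x - y = (x - z) - (y - z) := by abel
  rw [e1, e2, norm_sub_rev z x, norm_add_sq_real, norm_sub_sq_real (x - z), norm_smul, norm_smul,
    mul_pow, mul_pow, Real.norm_eq_abs, Real.norm_eq_abs, sq_abs, sq_abs, inner_smul_left,
    inner_smul_right]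
  simp only [conj_trivial]
  ring

/-- Comparison with the second point taken at the vertex `z` reduces this to Stewart's identity
`norm_sq_affine` in the plane. -/
theorem dist_geoComb_sq_le [CAT0Space X] (x y z : X) (a : Set.Icc (0 : ℝ) 1) :
    dist (geoComb x y a) z ^ 2 ≤ (1 - (a : ℝ)) * dist x z ^ 2 + a * dist y z ^ 2
      - a * (1 - a) * dist x y ^ 2 := by
  obtain ⟨x', y', z', h1, h2, h3⟩ := exists_comparison_triangle
    (dist_nonneg : 0 ≤ dist x y) (dist_nonneg : 0 ≤ dist z x) (dist_nonneg : 0 ≤ dist y z)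
    (by linarith [dist_triangle x z y, dist_comm x z, dist_comm y z])
    (by linarith [dist_triangle z y x, dist_comm x y, dist_comm y z])
    (by linarith [dist_triangle y x z, dist_comm x y, dist_comm z x])
  have h := CAT0Space.comparison x y z x' y' z' h1 h2 h3 a ⟨1, zero_le_one, le_rfl⟩
  rw [geoComb_one x z ⟨zero_le_one, le_rfl⟩] at h
  simp only [sub_self, zero_smul, one_smul, zero_add] at h
  calc dist (geoComb x y a) z ^ 2 ≤ _ := pow_le_pow_left₀ dist_nonneg h 2
    _ = _ := by rw [norm_sq_affine, ← h1, ← h2, ← h3, dist_comm z x]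

/-! ### Strongly convex functions and their minimizers. -/

/-- The midpoint of the geodesic from `x` to `y`. -/
noncomputable def geoMid [UniquelyGeodesic X] (x y : X) : X :=
  geoComb x y ⟨1 / 2, by norm_num, by norm_num⟩

/-- Nonnegative functions sharing the strong midpoint convexity and the quadratic growth of
`y ↦ d(y, w) ^ 2`. -/
structure IsQuadraticGauge [UniquelyGeodesic X] (g : X → ℝ) : Prop where
  nonneg : ∀ y, 0 ≤ g y
  mid : ∀ y z, g (geoMid y z) ≤ (g y + g z) / 2 - dist y z ^ 2 / 4
  growth : ∀ ε > 0, ∀ y z, g y ≤ (1 + ε) * g z + (1 + ε⁻¹) * dist y z ^ 2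

theorem isQuadraticGauge_dist_sq [CAT0Space X] (w : X) :
    IsQuadraticGauge fun y => dist y w ^ 2 where
  nonneg _ := sq_nonneg _
  mid y z := by
    have := dist_geoComb_sq_le y z w ⟨1 / 2, by norm_num, by norm_num⟩
    simp only at this
    rw [geoMid]
    linarith
  growth ε hε y z := by
    have h1 : dist y w ^ 2 ≤ (dist y z + dist z w) ^ 2 :=
      pow_le_pow_left₀ dist_nonneg (dist_triangle _ _ _) 2
    -- Young's inequality, with its defect written as a square.
    have h2 : (1 + ε) * dist z w ^ 2 + (1 + ε⁻¹) * dist y z ^ 2 - (dist y z + dist z w) ^ 2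
        = ε⁻¹ * (ε * dist z w - dist y z) ^ 2 := by
      field_simp
      ring
    have h3 : 0 ≤ ε⁻¹ * (ε * dist z w - dist y z) ^ 2 := by positivity
    linarith

theorem IsQuadraticGauge.weighted_average [UniquelyGeodesic X] {ι : Type*} {s : Finset ι}
    {w : ι → ℝ} {g : ι → X → ℝ} (hw : ∀ i, 0 ≤ w i) (hs : 0 < ∑ i ∈ s, w i)
    (hg : ∀ i, IsQuadraticGauge (g i)) :
    IsQuadraticGauge fun y => (∑ i ∈ s, w i * g i y) / ∑ i ∈ s, w i where
  nonneg y := div_nonneg (Finset.sum_nonneg fun i _ => mul_nonneg (hw i) ((hg i).nonneg y)) hs.le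
  mid y z := by
    have h : ∑ i ∈ s, w i * g i (geoMid y z) ≤
        ∑ i ∈ s, ((w i * g i y + w i * g i z) / 2 - w i * (dist y z ^ 2 / 4)) :=
      Finset.sum_le_sum fun i _ => by nlinarith [hw i, (hg i).mid y z]
    rw [Finset.sum_sub_distrib, ← Finset.sum_div, Finset.sum_add_distrib, ← Finset.sum_mul] at h
    rw [div_le_iff₀ hs]
    refine h.trans_eq ?_
    field_simp
  growth ε hε y z := by
    have h : ∑ i ∈ s, w i * g i y ≤
        ∑ i ∈ s, ((1 + ε) * (w i * g i z) + w i * ((1 + ε⁻¹) * dist y z ^ 2)) :=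
      Finset.sum_le_sum fun i _ => by
        nlinarith [mul_le_mul_of_nonneg_left ((hg i).growth ε hε y z) (hw i)]
    rw [Finset.sum_add_distrib, ← Finset.sum_mul, ← Finset.mul_sum] at h
    rw [div_le_iff₀ hs]
    refine h.trans_eq ?_
    field_simp

theorem IsQuadraticGauge.limsup [UniquelyGeodesic X] {g : ℕ → X → ℝ}
    (hg : ∀ n, IsQuadraticGauge (g n)) (hM : ∀ y, ∃ M, ∀ n, g n y ≤ M) :
    IsQuadraticGauge fun y => limsup (fun n => g n y) atTop where
  nonneg y := le_limsup_of_frequently_le (Frequently.of_forall fun n => (hg n).nonneg y)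
    (isBoundedUnder_of (hM y))
  mid y z := by
    refine le_of_forall_pos_le_add fun ε hε => limsup_le_of_nonneg (fun n => (hg n).nonneg _) ?_
    filter_upwards [eventually_lt_of_limsup_lt_of_bdd (hM y) (lt_add_of_pos_right _ hε),
      eventually_lt_of_limsup_lt_of_bdd (hM z) (lt_add_of_pos_right _ hε)] with n h1 h2
    linarith [(hg n).mid y z]
  growth ε hε y z := by
    refine le_of_forall_pos_le_add fun δ hδ => limsup_le_of_nonneg (fun n => (hg n).nonneg _) ?_
    have hδ' : 0 < δ / (1 + ε) := by positivity
    filter_upwards [eventually_lt_of_limsup_lt_of_bdd (hM z) (lt_add_of_pos_right _ hδ')] with n h1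
    have h2 := mul_le_mul_of_nonneg_left h1.le (by positivity : 0 ≤ 1 + ε)
    rw [mul_add, mul_div_cancel₀ _ (by positivity)] at h2
    linarith [(hg n).growth ε hε y z]

/-- Midpoint convexity makes minimizing sequences Cauchy; `growth` replaces continuity in passing to
the limit and, unlike a Lipschitz bound, survives averages and upper limits. -/
theorem IsQuadraticGauge.exists_minimizer [UniquelyGeodesic X] [Nonempty X] [CompleteSpace X]
    {g : X → ℝ} (hg : IsQuadraticGauge g) : ∃ p, ∀ y, g p + dist p y ^ 2 / 2 ≤ g y := by
  have hbdd : BddBelow (Set.range g) := ⟨0, by rintro _ ⟨y, rfl⟩; exact hg.nonneg y⟩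
  have hI : ∀ y, ⨅ y, g y ≤ g y := ciInf_le hbdd
  set I := ⨅ y, g y
  have hex : ∀ k : ℕ, ∃ y, g y < I + 1 / ((k : ℝ) + 1) := fun k =>
    exists_lt_of_ciInf_lt (lt_add_of_pos_right _ (by positivity))
  choose y hy using hex
  have hlim : Tendsto (fun k : ℕ => 1 / ((k : ℝ) + 1)) atTop (𝓝 0) :=
    tendsto_one_div_add_atTop_nhds_zero_nat
  have hcau : CauchySeq y := by
    refine cauchySeq_of_le_tendsto_0 (fun N : ℕ => √(4 * (1 / ((N : ℝ) + 1)))) ?_ ?_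
    · intro n m N hn hm
      refine Real.le_sqrt_of_sq_le ?_
      have h1 := one_div_le_one_div_of_le (by positivity : (0 : ℝ) < N + 1)
        (by gcongr : (N : ℝ) + 1 ≤ n + 1)
      have h2 := one_div_le_one_div_of_le (by positivity : (0 : ℝ) < N + 1)
        (by gcongr : (N : ℝ) + 1 ≤ m + 1)
      linarith [hg.mid (y n) (y m), hI (geoMid (y n) (y m)), hy n, hy m]
    · simpa using (hlim.const_mul 4).sqrt
  obtain ⟨p, hp⟩ := cauchySeq_tendsto_of_complete hcau
  have hdist : Tendsto (fun k => dist p (y k) ^ 2) atTop (𝓝 0) := by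
    simpa using ((tendsto_const_nhds (x := p)).dist hp).pow 2
  have hε : ∀ ε > 0, g p ≤ (1 + ε) * I := by
    intro ε hε
    have ht : Tendsto (fun k : ℕ => (1 + ε) * (I + 1 / ((k : ℝ) + 1))
        + (1 + ε⁻¹) * dist p (y k) ^ 2) atTop (𝓝 ((1 + ε) * I)) := by
      simpa using ((hlim.const_add I).const_mul (1 + ε)).add (hdist.const_mul (1 + ε⁻¹))
    refine ge_of_tendsto' ht fun k => (hg.growth ε hε p (y k)).trans ?_
    gcongr
    exact (hy k).le
  -- Let `ε = 1/(k+1)` tend to `0`.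
  have hpI : g p ≤ I := by
    have ht : Tendsto (fun k : ℕ => (1 + 1 / ((k : ℝ) + 1)) * I) atTop (𝓝 I) := by
      simpa using (hlim.const_add 1).mul_const I
    exact ge_of_tendsto' ht fun k => hε _ (by positivity)
  exact ⟨p, fun z => by linarith [hg.mid p z, hI (geoMid p z)]⟩

/-! ### Asymptotic centers of bounded sequences. -/

section AsymptoticCenter

theorem exists_dist_sq_le {x : ℕ → X} (hb : Bornology.IsBounded (Set.range x)) (y : X) :
    ∃ M, ∀ n, dist y (x n) ^ 2 ≤ M := by
  obtain ⟨r, hr⟩ := hb.subset_closedBall y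
  refine ⟨r ^ 2, fun n => pow_le_pow_left₀ dist_nonneg ?_ 2⟩
  rw [dist_comm]
  exact hr ⟨n, rfl⟩

/-- Bridges the `[0,∞]`-valued upper limits defining asymptotic centers and the real ones that are
minimized. -/
theorem limsup_edist_sq {x : ℕ → X} (hb : Bornology.IsBounded (Set.range x)) (y : X) :
    limsup (fun n => edist y (x n)) atTop ^ 2 =
      ENNReal.ofReal (limsup (fun n => dist y (x n) ^ 2) atTop) := by
  have h1 := Monotone.map_limsup_of_continuousAt (F := atTop) (f := fun t : ℝ≥0∞ => t ^ 2)
    (fun s t h => pow_le_pow_left' h 2) (fun n => edist y (x n))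
    (ENNReal.continuous_pow 2).continuousAt
  have h2 := Monotone.map_limsup_of_continuousAt (F := atTop)
    (fun s t h => ENNReal.ofReal_le_ofReal h) (fun n => dist y (x n) ^ 2)
    ENNReal.continuous_ofReal.continuousAt (isBoundedUnder_of (exists_dist_sq_le hb y))
    (isBoundedUnder_of ⟨0, fun _ => sq_nonneg _⟩ :
      IsBoundedUnder (· ≥ ·) atTop _).isCoboundedUnder_le
  rw [h1, h2]
  congr 1
  ext n
  simp [edist_dist, ENNReal.ofReal_pow]

theorem asymptoticCenter_eq_singleton {x : ℕ → X} (hb : Bornology.IsBounded (Set.range x)) {p : X}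
    (hp : ∀ y, limsup (fun n => dist p (x n) ^ 2) atTop + dist p y ^ 2 / 2 ≤
      limsup (fun n => dist y (x n) ^ 2) atTop) :
    asymptoticCenter x = {p} := by
  have hle : ∀ y, limsup (fun n => edist p (x n)) atTop ≤ limsup (fun n => edist y (x n)) atTop := by
    intro y
    refine (ENNReal.pow_le_pow_left_iff two_ne_zero).1 ?_
    rw [limsup_edist_sq hb, limsup_edist_sq hb]
    exact ENNReal.ofReal_le_ofReal (by linarith [hp y, sq_nonneg (dist p y)])
  have hinf : ⨅ y : X, limsup (fun n => edist y (x n)) atTop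
      = limsup (fun n => edist p (x n)) atTop :=
    le_antisymm (iInf_le _ p) (le_iInf hle)
  ext u
  simp only [asymptoticCenter, Set.mem_ofPred_eq, Set.mem_singleton_iff, hinf]
  refine ⟨fun h => ?_, fun h => by rw [h]⟩
  have h2 := congrArg (· ^ 2) h
  simp only [limsup_edist_sq hb] at h2
  have h0 : ∀ y, 0 ≤ limsup (fun n => dist y (x n) ^ 2) atTop := fun y =>
    le_limsup_of_frequently_le (Frequently.of_forall fun n => sq_nonneg _)
      (isBoundedUnder_of (exists_dist_sq_le hb y))
  rw [ENNReal.ofReal_eq_ofReal_iff (h0 u) (h0 p)] at h2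
  have h3 : dist p u ^ 2 = 0 := le_antisymm (by linarith [hp u]) (sq_nonneg _)
  exact (dist_eq_zero.1 (pow_eq_zero_iff two_ne_zero |>.1 h3)).symm

end AsymptoticCenter

/-! ### Inequalities for the resolvent. -/

section Resolvent

variable {A : X → Set (Dual X)} (hA : IsMonotoneOp A) (hR : RangeCondition A)

theorem mk_resolvent_mem (x : X) : Dual.mk 1 (resolvent hA hR x) x ∈ A (resolvent hA hR x) :=
  (existsUnique_resolvent hA hR x).choose_spec.1

/-- The resolvent is firmly metrically nonspreading. -/
theorem resolvent_dist_sq_le (x y : X) :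
    2 * dist (resolvent hA hR x) (resolvent hA hR y) ^ 2 ≤
      dist x (resolvent hA hR y) ^ 2 + dist y (resolvent hA hR x) ^ 2
        - dist x (resolvent hA hR x) ^ 2 - dist y (resolvent hA hR y) ^ 2 := by
  have hu := mk_resolvent_mem hA hR x
  have hv := mk_resolvent_mem hA hR y
  generalize resolvent hA hR x = u at *
  generalize resolvent hA hR y = v at *
  have h : 0 ≤ 1 * quasilin u x v u - 1 * quasilin v y v u := hA u v _ _ hu hv
  simp only [quasilin, dist_self, dist_comm v u] at h
  linarith

/-- Since `0 = [pp]`, the left side is the defining property of the resolvent at `p` with value `p`.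
-/
theorem mem_zeroSet_iff [Nonempty X] (p : X) : p ∈ zeroSet A ↔ resolvent hA hR p = p := by
  rw [zeroSet, Set.mem_ofPred_eq, ← Dual.mk_self 1 p]
  exact ⟨fun h => (existsUnique_resolvent hA hR p).unique (mk_resolvent_mem hA hR p) h,
    fun h => by simpa only [h] using mk_resolvent_mem hA hR p⟩

theorem resolvent_dist_sq_le_of_fixed {p : X} (hp : resolvent hA hR p = p) (x : X) :
    dist (resolvent hA hR x) p ^ 2 ≤ dist x p ^ 2 - dist x (resolvent hA hR x) ^ 2 := by
  have h := resolvent_dist_sq_le hA hR x p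
  rw [hp, dist_self, dist_comm p] at h
  linarith

theorem isBounded_range_resolvent {x : ℕ → X} (hb : Bornology.IsBounded (Set.range x)) :
    Bornology.IsBounded (Set.range fun n => resolvent hA hR (x n)) := by
  set J := resolvent hA hR
  obtain ⟨r, hr⟩ := hb.subset_closedBall (J (x 0))
  have hr' : ∀ n, dist (x n) (J (x 0)) ≤ r := fun n => hr ⟨n, rfl⟩
  have hr0 : 0 ≤ r := dist_nonneg.trans (hr' 0)
  -- With `t = d(J x_n, J x_0)` the nonspreading inequality gives `2t² ≤ r² + (r+t)²`, which fails
  -- for `t > 3r`.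
  refine (Metric.isBounded_closedBall (x := J (x 0)) (r := 3 * r)).subset ?_
  rintro _ ⟨n, rfl⟩
  rw [Metric.mem_closedBall]
  have h1 : 2 * dist (J (x n)) (J (x 0)) ^ 2 ≤ _ := resolvent_dist_sq_le hA hR (x n) (x 0)
  have h2 : dist (x 0) (J (x n)) ≤ r + dist (J (x n)) (J (x 0)) := by
    linarith [dist_triangle_right (x 0) (J (x n)) (J (x 0)), hr' 0]
  have h3 := pow_le_pow_left₀ dist_nonneg h2 2
  have h4 := pow_le_pow_left₀ dist_nonneg (hr' n) 2
  have h0 : 0 ≤ dist (J (x n)) (J (x 0)) := dist_nonneg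
  by_contra! hlt
  nlinarith [sq_nonneg (dist (x n) (J (x n))), sq_nonneg (dist (x 0) (J (x 0)))]

/-- If `d(x n, J (x n)) → 0`, then `J` does not increase the asymptotic radius function. -/
theorem limsup_dist_resolvent_le {x : ℕ → X} (hb : Bornology.IsBounded (Set.range x))
    (hreg : Tendsto (fun n => dist (x n) (resolvent hA hR (x n))) atTop (𝓝 0)) (q : X) :
    limsup (fun n => dist (resolvent hA hR q) (x n) ^ 2) atTop ≤
      limsup (fun n => dist q (x n) ^ 2) atTop := by
  set J := resolvent hA hR
  obtain ⟨r, hr⟩ := hb.subset_closedBall q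
  obtain ⟨s, hs⟩ := hb.subset_closedBall (J q)
  -- With `e = d(x_n, J x_n)`, `C = d(x_n, J q)`, `D = d(x_n, q)`: `2C² - 4Ce ≤ 2 d(J x_n, J q)² ≤
  -- C² + (D+e)²`, so the error is at most `e(4C + 2D + e)`.
  refine limsup_le_limsup_of_le_add (fun _ => sq_nonneg _) (exists_dist_sq_le hb q)
    (δ := fun n => dist (x n) (J (x n)) * (4 * s + 2 * r + dist (x n) (J (x n)))) ?_ fun n => ?_
  · simpa using hreg.mul (hreg.const_add (4 * s + 2 * r))
  · have hr' : dist (x n) q ≤ r := hr ⟨n, rfl⟩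
    have hs' : dist (x n) (J q) ≤ s := hs ⟨n, rfl⟩
    have h1 : 2 * dist (J (x n)) (J q) ^ 2 ≤ _ := resolvent_dist_sq_le hA hR (x n) q
    have h2 := dist_triangle (x n) (J (x n)) (J q)
    have h3 := dist_triangle_left q (J (x n)) (x n)
    rw [dist_comm (J q), dist_comm q (x n)]
    have h4 := pow_le_pow_left₀ dist_nonneg h3 2
    have he : 0 ≤ dist (x n) (J (x n)) := dist_nonneg
    have hB : 0 ≤ dist (J (x n)) (J q) := dist_nonneg
    have hC : 0 ≤ dist (x n) (J q) := dist_nonneg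
    have h5 : dist (x n) (J q) ^ 2 - 2 * dist (x n) (J q) * dist (x n) (J (x n)) ≤
        dist (J (x n)) (J q) ^ 2 := by
      rcases le_total (dist (x n) (J q)) (dist (x n) (J (x n))) with h | h <;> nlinarith
    nlinarith [mul_le_mul_of_nonneg_left hr' he, mul_le_mul_of_nonneg_left hs' he,
      sq_nonneg (dist (x n) (J (x n))), sq_nonneg (dist q (J q))]

end Resolvent

/-! ### Convergence of the iteration. -/

section Iteration

variable [CAT0Space X] {A : X → Set (Dual X)} (hA : IsMonotoneOp A) (hR : RangeCondition A)
  {α : ℕ → ℝ} (hα : ∀ n, α n ∈ Set.Ioc (0 : ℝ) 1) {x : ℕ → X}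
  (hx : ∀ n, x (n + 1) = geoComb (x n) (resolvent hA hR (x n))
    ⟨α n, Set.Ioc_subset_Icc_self (hα n)⟩)

include hx

theorem dist_iterate_sq_le (n : ℕ) (y : X) :
    dist (x (n + 1)) y ^ 2 ≤
      (1 - α n) * dist (x n) y ^ 2 + α n * dist (resolvent hA hR (x n)) y ^ 2 := by
  have h := dist_geoComb_sq_le (x n) (resolvent hA hR (x n)) y
    ⟨α n, Set.Ioc_subset_Icc_self (hα n)⟩
  rw [← hx n] at h
  have h2 : 0 ≤ α n * (1 - α n) * dist (x n) (resolvent hA hR (x n)) ^ 2 :=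
    mul_nonneg (mul_nonneg (hα n).1.le (sub_nonneg.2 (hα n).2)) (sq_nonneg _)
  simp only at h
  linarith

theorem dist_iterate_sq_le_of_fixed {p : X} (hp : resolvent hA hR p = p) (n : ℕ) :
    dist (x (n + 1)) p ^ 2 ≤
      dist (x n) p ^ 2 - α n * dist (x n) (resolvent hA hR (x n)) ^ 2 := by
  have h1 := dist_iterate_sq_le hA hR hα hx n p
  have h2 := mul_le_mul_of_nonneg_left (resolvent_dist_sq_le_of_fixed hA hR hp (x n)) (hα n).1.le
  linarith

theorem antitone_dist_iterate_sq {p : X} (hp : resolvent hA hR p = p) :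
    Antitone fun n => dist (x n) p ^ 2 :=
  antitone_nat_of_succ_le fun n => by
    linarith [dist_iterate_sq_le_of_fixed hA hR hα hx hp n,
      mul_nonneg (hα n).1.le (sq_nonneg (dist (x n) (resolvent hA hR (x n))))]

theorem exists_tendsto_dist_iterate_sq {p : X} (hp : resolvent hA hR p = p) :
    ∃ l, Tendsto (fun n => dist (x n) p ^ 2) atTop (𝓝 l) :=
  ⟨_, tendsto_atTop_ciInf (antitone_dist_iterate_sq hA hR hα hx hp)
    ⟨0, by rintro _ ⟨n, rfl⟩; exact sq_nonneg _⟩⟩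

theorem isBounded_range_iterate {p : X} (hp : resolvent hA hR p = p) :
    Bornology.IsBounded (Set.range x) := by
  refine (Metric.isBounded_closedBall (x := p) (r := dist (x 0) p)).subset ?_
  rintro _ ⟨n, rfl⟩
  exact (pow_le_pow_iff_left₀ dist_nonneg dist_nonneg two_ne_zero).1
    (antitone_dist_iterate_sq hA hR hα hx hp (Nat.zero_le n))

theorem tendsto_dist_resolvent_iterate {p : X} (hp : resolvent hA hR p = p) {c : ℝ} (hc : 0 < c)
    (hcα : ∀ n, c ≤ α n) :
    Tendsto (fun n => dist (x n) (resolvent hA hR (x n))) atTop (𝓝 0) := by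
  obtain ⟨l, hl⟩ := exists_tendsto_dist_iterate_sq hA hR hα hx hp
  have h1 : Tendsto (fun n => c⁻¹ * (dist (x n) p ^ 2 - dist (x (n + 1)) p ^ 2)) atTop (𝓝 0) := by
    simpa using (hl.sub (hl.comp (tendsto_add_atTop_nat 1))).const_mul c⁻¹
  have h2 : Tendsto (fun n => dist (x n) (resolvent hA hR (x n)) ^ 2) atTop (𝓝 0) := by
    refine squeeze_zero (fun _ => sq_nonneg _) (fun n => ?_) h1
    rw [le_inv_mul_iff₀ hc]
    linarith [dist_iterate_sq_le_of_fixed hA hR hα hx hp n, mul_le_mul_of_nonneg_right (hcα n)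
      (sq_nonneg (dist (x n) (resolvent hA hR (x n))))]
  simpa [Real.sqrt_sq dist_nonneg] using h2.sqrt

/-- Summing the nonspreading inequality along the iteration. -/
theorem sum_dist_resolvent_le (y : X) (N : ℕ) :
    ∑ k ∈ Finset.range N, α k * dist (resolvent hA hR y) (resolvent hA hR (x k)) ^ 2
        + dist (x N) (resolvent hA hR y) ^ 2 ≤
      ∑ k ∈ Finset.range N, α k * dist y (resolvent hA hR (x k)) ^ 2
        + dist (x 0) (resolvent hA hR y) ^ 2 := by
  induction N with
  | zero => simp
  | succ N ih =>
    rw [Finset.sum_range_succ, Finset.sum_range_succ]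
    have h1 := dist_iterate_sq_le hA hR hα hx N (resolvent hA hR y)
    have h2 := resolvent_dist_sq_le hA hR (x N) y
    -- Of the two copies of `d(J x_N, J y)²`, one enters the sum and the other cancels against the
    -- convexity bound `h1`.
    have h3 := mul_le_mul_of_nonneg_left (show
      2 * dist (resolvent hA hR (x N)) (resolvent hA hR y) ^ 2 ≤
      dist (x N) (resolvent hA hR y) ^ 2 + dist y (resolvent hA hR (x N)) ^ 2 by
        linarith [sq_nonneg (dist (x N) (resolvent hA hR (x N))),
          sq_nonneg (dist y (resolvent hA hR y))]) (hα N).1.le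
    rw [dist_comm (resolvent hA hR y) (resolvent hA hR (x N))]
    linarith

theorem exists_fixed_of_isBounded [Nonempty X] [CompleteSpace X]
    (hsum : Tendsto (fun n => ∑ k ∈ Finset.range n, α k) atTop atTop)
    (hb : Bornology.IsBounded (Set.range x)) : ∃ p, resolvent hA hR p = p := by
  set J := resolvent hA hR
  -- Summing over `N + 1` terms keeps the total weight positive.
  have hS : ∀ N, 0 < ∑ k ∈ Finset.range (N + 1), α k := fun N =>
    Finset.sum_pos (fun k _ => (hα k).1) (by simp)
  set g : ℕ → X → ℝ := fun N y => (∑ k ∈ Finset.range (N + 1), α k * dist y (J (x k)) ^ 2)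
    / ∑ k ∈ Finset.range (N + 1), α k with hg
  have hgauge : ∀ N, IsQuadraticGauge (g N) := fun N =>
    IsQuadraticGauge.weighted_average (g := fun k y => dist y (J (x k)) ^ 2)
      (fun k => (hα k).1.le) (hS N) fun k => isQuadraticGauge_dist_sq _
  have hM : ∀ y, ∃ M, ∀ N, g N y ≤ M := by
    intro y
    obtain ⟨M, hM⟩ := exists_dist_sq_le (isBounded_range_resolvent hA hR hb) y
    refine ⟨M, fun N => ?_⟩
    rw [hg, div_le_iff₀ (hS N), Finset.mul_sum]
    refine Finset.sum_le_sum fun k _ => ?_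
    rw [mul_comm M]
    exact mul_le_mul_of_nonneg_left (hM k) (hα k).1.le
  obtain ⟨p, hp⟩ := (IsQuadraticGauge.limsup hgauge hM).exists_minimizer
  have hJ : limsup (fun N => g N (J p)) atTop ≤ limsup (fun N => g N p) atTop := by
    refine limsup_le_limsup_of_le_add (fun N => (hgauge N).nonneg _) (hM p)
      (δ := fun N => dist (x 0) (J p) ^ 2 / ∑ k ∈ Finset.range (N + 1), α k)
      (tendsto_const_nhds.div_atTop (hsum.comp (tendsto_add_atTop_nat 1))) fun N => ?_
    rw [hg, ← add_div]
    refine div_le_div_of_nonneg_right ?_ (hS N).le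
    linarith [sum_dist_resolvent_le hA hR hα hx p (N + 1), sq_nonneg (dist (x (N + 1)) (J p))]
  have h3 : dist p (J p) ^ 2 = 0 := le_antisymm (by linarith [hp (J p)]) (sq_nonneg _)
  exact ⟨p, (dist_eq_zero.1 (pow_eq_zero_iff two_ne_zero |>.1 h3)).symm⟩

theorem exists_deltaConverges_fixed [Nonempty X] [CompleteSpace X] {q : X}
    (hq : resolvent hA hR q = q) {c : ℝ} (hc : 0 < c) (hcα : ∀ n, c ≤ α n) :
    ∃ p, resolvent hA hR p = p ∧ DeltaConverges x p := by
  have hb := isBounded_range_iterate hA hR hα hx hq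
  have hreg := tendsto_dist_resolvent_iterate hA hR hα hx hq hc hcα
  have hbφ : ∀ φ : ℕ → ℕ, Bornology.IsBounded (Set.range (x ∘ φ)) := fun φ =>
    hb.subset (Set.range_comp_subset_range φ x)
  have key : ∀ φ : ℕ → ℕ, StrictMono φ → ∃ p, resolvent hA hR p = p ∧
      ∀ y, limsup (fun n => dist p (x (φ n)) ^ 2) atTop + dist p y ^ 2 / 2 ≤
        limsup (fun n => dist y (x (φ n)) ^ 2) atTop := by
    intro φ hφ
    obtain ⟨p, hp⟩ := (IsQuadraticGauge.limsup (g := fun n y => dist y (x (φ n)) ^ 2)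
      (fun n => isQuadraticGauge_dist_sq _) (exists_dist_sq_le (hbφ φ))).exists_minimizer
    refine ⟨p, ?_, hp⟩
    have hJ := limsup_dist_resolvent_le hA hR (hbφ φ) (hreg.comp hφ.tendsto_atTop) p
    simp only [Function.comp_apply] at hJ
    have h3 : dist p (resolvent hA hR p) ^ 2 = 0 :=
      le_antisymm (by linarith [hp (resolvent hA hR p)]) (sq_nonneg _)
    exact (dist_eq_zero.1 (pow_eq_zero_iff two_ne_zero |>.1 h3)).symm
  -- At fixed points the subsequence does not affect the upper limit, so the two minimality
  -- inequalities below compare the same quantities.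
  have hlim : ∀ φ : ℕ → ℕ, StrictMono φ → ∀ p, resolvent hA hR p = p →
      limsup (fun n => dist p (x (φ n)) ^ 2) atTop = limsup (fun n => dist p (x n) ^ 2) atTop := by
    intro φ hφ p hp
    obtain ⟨l, hl⟩ := exists_tendsto_dist_iterate_sq hA hR hα hx hp
    simp only [dist_comm p]
    rw [hl.limsup_eq]
    exact (hl.comp hφ.tendsto_atTop).limsup_eq
  obtain ⟨p, hp, hmin⟩ := key id strictMono_id
  simp only [id] at hmin
  refine ⟨p, hp, fun φ hφ => ?_⟩
  obtain ⟨u, hu, humin⟩ := key φ hφ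
  have h1 := humin p
  have h2 := hmin u
  rw [hlim φ hφ u hu, hlim φ hφ p hp] at h1
  have h3 : dist u p ^ 2 = 0 :=
    le_antisymm (by linarith [sq_nonneg (dist p u)]) (sq_nonneg _)
  obtain rfl : u = p := dist_eq_zero.1 (pow_eq_zero_iff two_ne_zero |>.1 h3)
  exact asymptoticCenter_eq_singleton (hbφ φ) humin

end Iteration

end CAT0

/-! ### The main theorem. -/

theorem corollary6p3 {X : Type*} [MetricSpace X] [Nonempty X] [CAT0.CAT0Space X]
    [CompleteSpace X] (A : X → Set (CAT0.Dual X)) (hA : CAT0.IsMonotoneOp A)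
    (hR : CAT0.RangeCondition A) (α : ℕ → ℝ) (hα : ∀ n, α n ∈ Set.Ioc (0 : ℝ) 1)
    (hsum : Filter.Tendsto (fun n => ∑ k ∈ Finset.range n, α k) Filter.atTop Filter.atTop)
    (x : ℕ → X)
    (hx : ∀ n, x (n + 1) = CAT0.geoComb (x n) (CAT0.resolvent hA hR (x n))
      ⟨α n, Set.Ioc_subset_Icc_self (hα n)⟩) :
    ((CAT0.zeroSet A).Nonempty ↔ Bornology.IsBounded (Set.range x)) ∧
    ((CAT0.zeroSet A).Nonempty → 0 < ⨅ n, α n * (1 - α n) →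
      ∃ p ∈ CAT0.zeroSet A, CAT0.DeltaConverges x p) := by
  refine ⟨⟨?_, fun hb => ?_⟩, ?_⟩
  · rintro ⟨p, hp⟩
    exact CAT0.isBounded_range_iterate hA hR hα hx ((CAT0.mem_zeroSet_iff hA hR p).1 hp)
  · obtain ⟨p, hp⟩ := CAT0.exists_fixed_of_isBounded hA hR hα hx hsum hb
    exact ⟨p, (CAT0.mem_zeroSet_iff hA hR p).2 hp⟩
  · rintro ⟨q, hq⟩ hc
    have hbdd : BddBelow (Set.range fun n => α n * (1 - α n)) := by
      refine ⟨0, ?_⟩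
      rintro _ ⟨n, rfl⟩
      exact mul_nonneg (hα n).1.le (sub_nonneg.2 (hα n).2)
    -- The infimum bounds `α_n` below, because `α_n (1 - α_n) ≤ α_n`.
    obtain ⟨p, hp, hΔ⟩ := CAT0.exists_deltaConverges_fixed hA hR hα hx
      ((CAT0.mem_zeroSet_iff hA hR q).1 hq) hc fun n =>
        (ciInf_le hbdd n).trans (by nlinarith [sq_nonneg (α n)])
    exact ⟨p, (CAT0.mem_zeroSet_iff hA hR p).2 hp, hΔ⟩
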